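/- Let $G$ be a group acting transitively on a finite set $\Omega$, and let $\mathcal{K}(G)$ be the homogeneous coherent configuration on $\Omega$ whose relations are the orbitals of $G$, i.e. the orbits of $G$ on $\Omega\times\Omega$. Let $\mathcal{A}$ be its adjacency algebra, i.e. the $\mathbb{C}$-span of the adjacency matrices of the orbitals. The symmetrisation $\mathcal{K}(G)^{\mathrm{Sym}}$ is the partition of $\Omega\times\Omega$ obtained by keeping each symmetric orbital and replacing each pair of nonsymmetric converse orbitals by their union; $\mathcal{K}(G)$ is called stratifiable if $\mathcal{K}(G)^{\mathrm{Sym}}$ is an association scheme, i.e. a commutative homogeneous coherent configuration. If $\mathcal{K}(G)$ is stratifiable, then every minimal idempotent of the complex adjacency algebra (Bose–Mesner algebra) of $\mathcal{K}(G)^{\mathrm{Sym}}$ is of the form $\Pi$ or $\Pi+\Pi^{\top}$, where $\Pi$ is a central primitive idempotent of $\mathcal{A}$ and $\Pi^{\top}$ denotes its transpose. -/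

import Mathlib

noncomputable section

/-- The converse `{(x, y) : (y, x) ∈ R}` of a binary relation `R` on `Ω`. -/
def converseRel {Ω : Type*} (R : Set (Ω × Ω)) : Set (Ω × Ω) :=
  {p | (p.2, p.1) ∈ R}

/-- The number of `z` such that `(x, z) ∈ R` and `(z, y) ∈ S`. -/
def pathCount {Ω : Type*} (R S : Set (Ω × Ω)) (x y : Ω) : ℕ :=
  {z : Ω | (x, z) ∈ R ∧ (z, y) ∈ S}.ncard

/-- Homogeneous coherent configurations on `Ω`, given by their set of relations.
`Setoid.IsPartition` includes that all the relations are nonempty. -/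
structure IsHomogeneousCoherentConfiguration {Ω : Type*} (C : Set (Set (Ω × Ω))) : Prop where
  diagonal_mem : Set.diagonal Ω ∈ C
  isPartition : Setoid.IsPartition C
  converse_mem : ∀ R ∈ C, converseRel R ∈ C
  pathCount_eq : ∀ R ∈ C, ∀ S ∈ C, ∀ T ∈ C, ∀ p ∈ T, ∀ q ∈ T,
    pathCount R S p.1 p.2 = pathCount R S q.1 q.2

/-- An association scheme: a commutative homogeneous coherent configuration. -/
structure IsAssociationScheme {Ω : Type*} (C : Set (Set (Ω × Ω))) : Prop extends
    IsHomogeneousCoherentConfiguration C where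
  pathCount_comm : ∀ R ∈ C, ∀ S ∈ C, ∀ x y : Ω, pathCount R S x y = pathCount S R x y

/-- The symmetrisation: a symmetric relation is kept (then `R ∪ converseRel R = R`), and a pair of
nonsymmetric converse relations is replaced by its union. -/
def symmetrisation {Ω : Type*} (C : Set (Set (Ω × Ω))) : Set (Set (Ω × Ω)) :=
  (fun R => R ∪ converseRel R) '' C

/-- A homogeneous coherent configuration is stratifiable if its symmetrisation is an association
scheme. -/
def IsStratifiable {Ω : Type*} (C : Set (Set (Ω × Ω))) : Prop :=
  IsAssociationScheme (symmetrisation C)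

/-- The set `K(G)` of orbitals of `G` on `Ω`: the orbits of `G` on `Ω × Ω` under the diagonal
action. -/
def orbitalConfiguration (G Ω : Type*) [Group G] [MulAction G Ω] : Set (Set (Ω × Ω)) :=
  Set.range fun p : Ω × Ω => MulAction.orbit G p

/-- The complex adjacency matrix of a relation. -/
def relAdjMatrix {Ω : Type*} (R : Set (Ω × Ω)) : Matrix Ω Ω ℂ :=
  Matrix.of fun x y => R.indicator (fun _ => (1 : ℂ)) (x, y)

/-- The complex adjacency algebra (the Bose–Mesner algebra, for an association scheme), as the
linear span of the adjacency matrices; for a coherent configuration it is closed under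
multiplication and contains the identity matrix. -/
def adjacencyAlgebra {Ω : Type*} (C : Set (Set (Ω × Ω))) : Submodule ℂ (Matrix Ω Ω ℂ) :=
  Submodule.span ℂ (relAdjMatrix '' C)

/-- `e` is a minimal (i.e. primitive) idempotent of `A`: a nonzero idempotent such that the only
idempotents `f` of `A` below it (`e * f = f = f * e`) are `0` and `e`. -/
structure IsMinimalIdempotent {Ω : Type*} [Fintype Ω] (A : Submodule ℂ (Matrix Ω Ω ℂ))
    (e : Matrix Ω Ω ℂ) : Prop where
  mem : e ∈ A
  idem : IsIdempotentElem e
  ne_zero : e ≠ 0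
  minimal : ∀ f ∈ A, IsIdempotentElem f → e * f = f → f * e = f → f = 0 ∨ f = e

/-- `e` is a central idempotent of `A`. -/
structure IsCentralIdempotent {Ω : Type*} [Fintype Ω] (A : Submodule ℂ (Matrix Ω Ω ℂ))
    (e : Matrix Ω Ω ℂ) : Prop where
  mem : e ∈ A
  idem : IsIdempotentElem e
  central : ∀ a ∈ A, e * a = a * e

/-- `e` is a central primitive idempotent of `A`: it is nonzero and minimal among the nonzero
central idempotents. For semisimple `A` these are the identity elements of the simple components. -/
structure IsCentralPrimitiveIdempotent {Ω : Type*} [Fintype Ω]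
    (A : Submodule ℂ (Matrix Ω Ω ℂ)) (e : Matrix Ω Ω ℂ) : Prop extends
    IsCentralIdempotent A e where
  ne_zero : e ≠ 0
  primitive : ∀ f, IsCentralIdempotent A f → e * f = f → f = 0 ∨ f = e

end

open Matrix

/-! ### Matrices constant on the classes of a partition. -/

section AdjacencyAlgebra

variable {Ω : Type*}

/-! The adjacency algebra `A` of the orbitals is closed under products and transposes, and that of
the symmetrisation is its set `B` of symmetric matrices, commutative by stratifiability. The
commutator of a symmetric matrix with a skew one is symmetric, which makes every symmetric
idempotent central in `A`. If a minimal idempotent `e` of `B` is not primitive among central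
idempotents, some central `f` lies strictly below it; minimality applied to the symmetric
idempotents `f * fᵀ` and `f + fᵀ` gives `e = f + fᵀ`. The argument is purely algebraic:
semisimplicity of `A` plays no role. -/

theorem relAdjMatrix_apply_of_mem {R : Set (Ω × Ω)} {x y : Ω} (h : (x, y) ∈ R) :
    relAdjMatrix R x y = 1 := by
  simp [relAdjMatrix, h]

theorem relAdjMatrix_apply_of_notMem {R : Set (Ω × Ω)} {x y : Ω} (h : (x, y) ∉ R) :
    relAdjMatrix R x y = 0 := by
  simp [relAdjMatrix, h]

/-- The adjacency algebra of a partition consists of the matrices that are constant on its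
classes. -/
theorem mem_adjacencyAlgebra_iff [Finite Ω] {C : Set (Set (Ω × Ω))} (hC : Setoid.IsPartition C)
    {M : Matrix Ω Ω ℂ} :
    M ∈ adjacencyAlgebra C ↔ ∀ R ∈ C, ∀ p ∈ R, ∀ q ∈ R, M p.1 p.2 = M q.1 q.2 := by
  classical
  constructor
  · intro hM R hR p hp q hq
    induction hM using Submodule.span_induction with
    | mem N hN =>
      obtain ⟨S, hS, rfl⟩ := hN
      by_cases h : R = S
      · subst h
        rw [relAdjMatrix_apply_of_mem hp, relAdjMatrix_apply_of_mem hq]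
      · have disj : Disjoint R S := hC.pairwiseDisjoint hR hS h
        rw [relAdjMatrix_apply_of_notMem (Set.disjoint_left.mp disj hp),
          relAdjMatrix_apply_of_notMem (Set.disjoint_left.mp disj hq)]
    | zero => rfl
    | add N N' _ _ h h' => simp only [Matrix.add_apply, h, h']
    | smul c N _ h => simp only [Matrix.smul_apply, h]
  · intro hM
    have hfin : C.Finite := Set.toFinite C
    have hval : ∀ R ∈ C, ∃ c : ℂ, ∀ p ∈ R, M p.1 p.2 = c := by
      intro R hR
      obtain ⟨q, hq⟩ := Setoid.nonempty_of_mem_partition hC hR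
      exact ⟨M q.1 q.2, fun p hp => hM R hR p hp q hq⟩
    choose! c hc using hval
    have hsum : M = ∑ R ∈ hfin.toFinset, c R • relAdjMatrix R := by
      ext x y
      obtain ⟨S, ⟨hS, hxy⟩, huniq⟩ := hC.2 (x, y)
      rw [Matrix.sum_apply, Finset.sum_eq_single S]
      · simp [relAdjMatrix_apply_of_mem hxy, ← hc S hS _ hxy]
      · intro R hR hne
        have : (x, y) ∉ R := fun h => hne (huniq R ⟨hfin.mem_toFinset.mp hR, h⟩)
        simp [relAdjMatrix_apply_of_notMem this]
      · exact fun h => absurd (hfin.mem_toFinset.mpr hS) h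
    rw [hsum]
    exact Submodule.sum_mem _ fun R hR => Submodule.smul_mem _ _
      (Submodule.subset_span ⟨R, hfin.mem_toFinset.mp hR, rfl⟩)

theorem relAdjMatrix_mul_apply [Fintype Ω] (R S : Set (Ω × Ω)) (x y : Ω) :
    (relAdjMatrix R * relAdjMatrix S) x y = pathCount R S x y := by
  classical
  have h : ∀ z, relAdjMatrix R x z * relAdjMatrix S z y =
      if (x, z) ∈ R ∧ (z, y) ∈ S then 1 else 0 := by
    intro z
    by_cases h₁ : (x, z) ∈ R <;> by_cases h₂ : (z, y) ∈ S <;> simp [relAdjMatrix, h₁, h₂]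
  rw [Matrix.mul_apply, Finset.sum_congr rfl fun z _ => h z, Finset.sum_boole, pathCount,
    Set.ncard_eq_toFinset_card']
  simp

/-- The Bose–Mesner algebra of an association scheme is commutative. -/
theorem IsAssociationScheme.mul_comm [Fintype Ω] {C : Set (Set (Ω × Ω))}
    (hC : IsAssociationScheme C) {M N : Matrix Ω Ω ℂ} (hM : M ∈ adjacencyAlgebra C)
    (hN : N ∈ adjacencyAlgebra C) : M * N = N * M := by
  refine Submodule.span_induction₂ (p := fun M N _ _ => M * N = N * M) ?_ ?_ ?_ ?_ ?_ ?_ ?_ hM hN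
  · rintro _ _ ⟨R, hR, rfl⟩ ⟨S, hS, rfl⟩
    ext x y
    rw [relAdjMatrix_mul_apply, relAdjMatrix_mul_apply, hC.pathCount_comm R hR S hS]
  · simp
  · simp
  · intro a b c _ _ _ h₁ h₂
    rw [add_mul, mul_add, h₁, h₂]
  · intro a b c _ _ _ h₁ h₂
    rw [add_mul, mul_add, h₁, h₂]
  · intro r a b _ _ h
    rw [smul_mul_assoc, mul_smul_comm, h]
  · intro r a b _ _ h
    rw [smul_mul_assoc, mul_smul_comm, h]

/-- The adjacency algebra of the symmetrisation consists of the symmetric matrices in the adjacency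
algebra of the configuration. -/
theorem mem_adjacencyAlgebra_symmetrisation_iff [Finite Ω] {C : Set (Set (Ω × Ω))}
    (hC : Setoid.IsPartition C) (hsym : Setoid.IsPartition (symmetrisation C))
    {M : Matrix Ω Ω ℂ} :
    M ∈ adjacencyAlgebra (symmetrisation C) ↔ M ∈ adjacencyAlgebra C ∧ Mᵀ = M := by
  rw [mem_adjacencyAlgebra_iff hC, mem_adjacencyAlgebra_iff hsym]
  constructor
  · intro h
    refine ⟨fun R hR p hp q hq => h _ ⟨R, hR, rfl⟩ p (Or.inl hp) q (Or.inl hq), ?_⟩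
    ext x y
    obtain ⟨R, ⟨hR, hxy⟩, -⟩ := hC.2 (x, y)
    exact h _ ⟨R, hR, rfl⟩ (y, x) (Or.inr hxy) (x, y) (Or.inl hxy)
  · rintro ⟨h, hT⟩ _ ⟨R, hR, rfl⟩ p hp q hq
    have hT' : ∀ x y, M x y = M y x := fun x y => congrFun (congrFun hT y) x
    rcases hp with hp | hp <;> rcases hq with hq | hq
    · exact h R hR p hp q hq
    · rw [hT' q.1]
      exact h R hR p hp _ hq
    · rw [hT' p.1]
      exact h R hR _ hp q hq
    · rw [hT' p.1, hT' q.1]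
      exact h R hR _ hp _ hq

end AdjacencyAlgebra

/-! ### The centraliser algebra of a permutation group. -/

section Orbitals

variable {G Ω : Type*} [Group G] [MulAction G Ω]

theorem isPartition_orbitalConfiguration : Setoid.IsPartition (orbitalConfiguration G Ω) := by
  refine ⟨?_, fun p => ⟨MulAction.orbit G p, ⟨⟨p, rfl⟩, MulAction.mem_orbit_self p⟩, ?_⟩⟩
  · rintro ⟨p, hp⟩
    exact (MulAction.nonempty_orbit p).ne_empty hp
  · rintro _ ⟨⟨q, rfl⟩, hq⟩
    exact (MulAction.orbit_eq_iff.mpr hq).symm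

/-- The adjacency algebra of the orbitals is the centraliser algebra of the permutation
representation. -/
theorem mem_adjacencyAlgebra_orbitalConfiguration_iff [Finite Ω] {M : Matrix Ω Ω ℂ} :
    M ∈ adjacencyAlgebra (orbitalConfiguration G Ω) ↔
      ∀ (g : G) (x y : Ω), M (g • x) (g • y) = M x y := by
  rw [mem_adjacencyAlgebra_iff isPartition_orbitalConfiguration]
  constructor
  · intro h g x y
    exact h _ ⟨(x, y), rfl⟩ (g • (x, y)) ⟨g, rfl⟩ (x, y) (MulAction.mem_orbit_self _)
  · rintro h _ ⟨r, rfl⟩ _ ⟨g, rfl⟩ _ ⟨k, rfl⟩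
    exact (h g r.1 r.2).trans (h k r.1 r.2).symm

theorem mul_mem_adjacencyAlgebra_orbitalConfiguration [Fintype Ω] {M N : Matrix Ω Ω ℂ}
    (hM : M ∈ adjacencyAlgebra (orbitalConfiguration G Ω))
    (hN : N ∈ adjacencyAlgebra (orbitalConfiguration G Ω)) :
    M * N ∈ adjacencyAlgebra (orbitalConfiguration G Ω) := by
  rw [mem_adjacencyAlgebra_orbitalConfiguration_iff] at *
  intro g x y
  -- Reindex the summation variable by `g`.
  rw [Matrix.mul_apply, Matrix.mul_apply, ← Equiv.sum_comp (MulAction.toPerm g)]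
  simp [hM, hN]

theorem transpose_mem_adjacencyAlgebra_orbitalConfiguration [Finite Ω] {M : Matrix Ω Ω ℂ}
    (hM : M ∈ adjacencyAlgebra (orbitalConfiguration G Ω)) :
    Mᵀ ∈ adjacencyAlgebra (orbitalConfiguration G Ω) := by
  rw [mem_adjacencyAlgebra_orbitalConfiguration_iff] at *
  exact fun g x y => hM g y x

end Orbitals

/-! ### Idempotents in matrix algebras closed under transposition. -/

section Idempotents

variable {Ω : Type*} [Fintype Ω] {A B : Submodule ℂ (Matrix Ω Ω ℂ)}

/-- If the symmetric matrices in a transpose-closed matrix algebra commute, then each symmetric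
idempotent of the algebra is central. -/
theorem IsIdempotentElem.isCentralIdempotent_of_symmetric_commute
    (hmul : ∀ a ∈ A, ∀ b ∈ A, a * b ∈ A) (htr : ∀ a ∈ A, aᵀ ∈ A)
    (hcomm : ∀ a ∈ A, ∀ b ∈ A, aᵀ = a → bᵀ = b → a * b = b * a)
    {e : Matrix Ω Ω ℂ} (he : IsIdempotentElem e) (heA : e ∈ A) (heT : eᵀ = e) :
    IsCentralIdempotent A e := by
  have hskew : ∀ k ∈ A, kᵀ = -k → e * k = k * e := by
    intro k hk hkT
    -- The commutator of `e` with a skew `k` is symmetric, hence commutes with `e`.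
    have hc : e * (e * k - k * e) = (e * k - k * e) * e := by
      refine hcomm e heA _ (A.sub_mem (hmul e heA k hk) (hmul k hk e heA)) heT ?_
      rw [transpose_sub, transpose_mul, transpose_mul, heT, hkT]
      noncomm_ring
    rw [mul_sub, sub_mul, ← mul_assoc, he.eq, mul_assoc k, he.eq, ← mul_assoc] at hc
    have h₁ : e * k = e * k * e := by
      have h := congrArg (e * ·) hc
      simp only [mul_sub, ← mul_assoc, he.eq] at h
      rwa [sub_self, sub_eq_zero] at h
    rw [← h₁, sub_self, eq_comm, sub_eq_zero] at hc
    exact hc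
  refine ⟨heA, he, fun a ha => ?_⟩
  -- Twice `a` is the sum of `a + aᵀ` (symmetric) and `a - aᵀ` (skew).
  have hs := hcomm e heA (a + aᵀ) (A.add_mem ha (htr a ha)) heT
    (by rw [transpose_add, transpose_transpose, add_comm])
  have hk := hskew (a - aᵀ) (A.sub_mem ha (htr a ha))
    (by rw [transpose_sub, transpose_transpose, neg_sub])
  have h2 : (2 : ℂ) • (e * a) = (2 : ℂ) • (a * e) := by
    have := congrArg₂ (· + ·) hs hk
    simp only [mul_add, add_mul, mul_sub, sub_mul] at this
    rw [two_smul, two_smul]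
    calc e * a + e * a = e * a + e * aᵀ + (e * a - e * aᵀ) := by abel
      _ = _ := this
      _ = a * e + a * e := by abel
  exact smul_right_injective _ (two_ne_zero' ℂ) h2

theorem IsCentralIdempotent.transpose (htr : ∀ a ∈ A, aᵀ ∈ A) {f : Matrix Ω Ω ℂ}
    (hf : IsCentralIdempotent A f) : IsCentralIdempotent A fᵀ where
  mem := htr f hf.mem
  idem := by rw [IsIdempotentElem, ← transpose_mul, hf.idem.eq]
  central a ha := by
    have h := congrArg Matrix.transpose (hf.central aᵀ (htr a ha))
    simp only [transpose_mul, transpose_transpose] at h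
    exact h.symm

/-- A central idempotent strictly between zero and a minimal symmetric idempotent `e` is orthogonal
to its transpose, and together they sum to `e`. -/
theorem IsMinimalIdempotent.eq_add_transpose
    (hmul : ∀ a ∈ A, ∀ b ∈ A, a * b ∈ A) (htr : ∀ a ∈ A, aᵀ ∈ A)
    (hB : ∀ a, a ∈ B ↔ a ∈ A ∧ aᵀ = a) {e f : Matrix Ω Ω ℂ} (he : IsMinimalIdempotent B e)
    (hec : IsCentralIdempotent A e) (hf : IsCentralIdempotent A f) (hef : e * f = f)
    (hf0 : f ≠ 0) (hfe : f ≠ e) : f * fᵀ = 0 ∧ e = f + fᵀ := by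
  have heT : eᵀ = e := ((hB e).mp he.mem).2
  have hfT := hf.transpose htr
  have hc : f * fᵀ = fᵀ * f := hf.central _ hfT.mem
  have hefT : e * fᵀ = fᵀ := by
    have h := congrArg Matrix.transpose hef
    rwa [transpose_mul, heT, ← hec.central _ hfT.mem] at h
  have hbelow : ∀ g, g ∈ A → gᵀ = g → IsIdempotentElem g → e * g = g → g = 0 ∨ g = e :=
    fun g hg hgT hgi heg => he.minimal g ((hB g).mpr ⟨hg, hgT⟩) hgi heg
      (by rw [← hec.central g hg, heg])
  -- The other option, `f * fᵀ = e`, would give `f = e * f = f * fᵀ * f = f * fᵀ = e`.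
  have h0 : f * fᵀ = 0 := by
    refine (hbelow (f * fᵀ) (hmul f hf.mem _ hfT.mem) ?_ ?_ ?_).resolve_right fun h => hfe ?_
    · rw [transpose_mul, transpose_transpose]
    · rw [IsIdempotentElem, mul_assoc, ← mul_assoc fᵀ, ← hc, mul_assoc, hfT.idem.eq, ← mul_assoc,
        hf.idem.eq]
    · rw [← mul_assoc, hef]
    · calc f = e * f := hef.symm
        _ = f * fᵀ * f := by rw [h]
        _ = f * f * fᵀ := by rw [mul_assoc, ← hc, mul_assoc]
        _ = e := by rw [hf.idem.eq, h]
  refine ⟨h0, ((hbelow (f + fᵀ) (A.add_mem hf.mem hfT.mem) ?_ ?_ ?_).resolve_left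
    fun h => hf0 ?_).symm⟩
  · rw [transpose_add, transpose_transpose, add_comm]
  · rw [IsIdempotentElem, mul_add, add_mul, add_mul, ← hc, h0, hf.idem.eq, hfT.idem.eq, add_zero,
      zero_add]
  · rw [mul_add, hef, hefT]
  · have h' := congrArg (f * ·) h
    simpa only [mul_add, hf.idem.eq, h0, add_zero, mul_zero] using h'

/-- If the symmetric matrices in a transpose-closed matrix algebra `A` commute, then each minimal
idempotent of the algebra of symmetric matrices is a central primitive idempotent of `A` or the sum
of one with its transpose. -/
theorem IsMinimalIdempotent.exists_isCentralPrimitiveIdempotent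
    (hmul : ∀ a ∈ A, ∀ b ∈ A, a * b ∈ A) (htr : ∀ a ∈ A, aᵀ ∈ A)
    (hB : ∀ a, a ∈ B ↔ a ∈ A ∧ aᵀ = a) (hcomm : ∀ a ∈ B, ∀ b ∈ B, a * b = b * a)
    {e : Matrix Ω Ω ℂ} (he : IsMinimalIdempotent B e) :
    ∃ p, IsCentralPrimitiveIdempotent A p ∧ (e = p ∨ e = p + pᵀ) := by
  obtain ⟨heA, heT⟩ := (hB e).mp he.mem
  have hec : IsCentralIdempotent A e :=
    he.idem.isCentralIdempotent_of_symmetric_commute hmul htr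
      (fun a ha b hb haT hbT => hcomm a ((hB a).mpr ⟨ha, haT⟩) b ((hB b).mpr ⟨hb, hbT⟩)) heA heT
  by_cases hprim : ∀ f, IsCentralIdempotent A f → e * f = f → f = 0 ∨ f = e
  · exact ⟨e, { hec with ne_zero := he.ne_zero, primitive := hprim }, Or.inl rfl⟩
  · push Not at hprim
    obtain ⟨f, hf, hef, hf0, hfe⟩ := hprim
    obtain ⟨h0, hsum⟩ := he.eq_add_transpose hmul htr hB hec hf hef hf0 hfe
    refine ⟨f, { hf with ne_zero := hf0, primitive := fun g hg hfg => ?_ }, Or.inr hsum⟩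
    rw [or_iff_not_imp_left]
    intro hg0
    have heg : e * g = g := by rw [← hfg, ← mul_assoc, hef]
    have hge : g ≠ e := by
      rintro rfl
      exact hfe (by rw [← hef, ← hf.central g heA, hfg])
    -- The same splitting holds for `g`, so `e = g + gᵀ`; multiplying by `f`, which kills `gᵀ`,
    -- yields `f = g`.
    obtain ⟨-, hsum'⟩ := he.eq_add_transpose hmul htr hB hec hg heg hg0 hge
    have hgT : fᵀ * gᵀ = gᵀ := by
      rw [← transpose_mul, ← hf.central g hg.mem, hfg]
    have hfgT : f * gᵀ = 0 := by rw [← hgT, ← mul_assoc, h0, zero_mul]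
    calc g = f * (g + gᵀ) := by rw [mul_add, hfg, hfgT, add_zero]
      _ = f * e := by rw [← hsum']
      _ = f := by rw [hf.central e heA, hef]

end Idempotents

theorem mainTheorem9 {G Ω : Type*} [Group G] [Fintype Ω] [MulAction G Ω]
    [MulAction.IsPretransitive G Ω]
    (hstrat : IsStratifiable (orbitalConfiguration G Ω))
    (E : Matrix Ω Ω ℂ)
    (hE : IsMinimalIdempotent (adjacencyAlgebra (symmetrisation (orbitalConfiguration G Ω))) E) :
    ∃ P : Matrix Ω Ω ℂ,
      IsCentralPrimitiveIdempotent (adjacencyAlgebra (orbitalConfiguration G Ω)) P ∧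
        (E = P ∨ E = P + P.transpose) := by
  have hstrat' : IsAssociationScheme (symmetrisation (orbitalConfiguration G Ω)) := hstrat
  exact hE.exists_isCentralPrimitiveIdempotent
    (fun _ ha _ hb => mul_mem_adjacencyAlgebra_orbitalConfiguration ha hb)
    (fun _ ha => transpose_mem_adjacencyAlgebra_orbitalConfiguration ha)
    (fun _ => mem_adjacencyAlgebra_symmetrisation_iff isPartition_orbitalConfiguration
      hstrat'.isPartition)
    (fun _ ha _ hb => hstrat'.mul_comm ha hb)
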